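/- Let $d,L$ be natural numbers. Let $A$ be an $L\times L$ transition (row-stochastic) matrix that has full rank and is irreducible and aperiodic, with stationary distribution $\pi=(\pi_1,\dots,\pi_L)$, and let $f_1,\dots,f_L$ be probability densities on $\mathbb{R}^d$ that are square integrable and linearly independent. Put $$p(z_1,z_2)=\sum_{\ell=1}^L \pi_\ell f_\ell(z_1)g_\ell(z_2),\qquad g_\ell=\sum_{m=1}^L A[\ell,m]f_m,$$ which is the density of a pair of consecutive observations of the hidden Markov model with $L$ states, transition matrix $A$, initial law $\pi$ and emission densities $f_\ell$. Assume that $p$ has partial derivatives up to order $3$ and that these belong to $L^1(\mathbb{R}^{d}\times\mathbb{R}^d)\cap L^2(\mathbb{R}^{d}\times\mathbb{R}^d)$. Let $K:\mathbb{R}\to\mathbb{R}$ be a kernel, $\int K(u)\,du=1$, that belongs to $L^1(\mathbb{R})\cap L^2(\mathbb{R})$, has a non-vanishing Fourier transform and satisfies $\int uK(u)\,du=0$ and $0<\int u^2K(u)\,du<\infty$ (the last integral converging absolutely). For $h>0$ let $K_h^d(u)=\prod_{j=1}^d K(u_j/h)/h$ and $$p_h(z_1,z_2)=\int_{\mathbb{R}^d\times\mathbb{R}^d}p(y_1,y_2)K_h^d(z_1-y_1)K_h^d(z_2-y_2)\,dy_1\,dy_2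 .$$ Let $T$ and $T_h$ be the integral operators on $L^2(\mathbb{R}^d)$ given by $[T\omega](z_2)=\int\omega(z_1)p(z_1,z_2)\,dz_1$ and $[T_h\omega](z_2)=\int\omega(z_1)p_h(z_1,z_2)\,dz_1$, and for a compact operator $S$ let $\sigma_\ell(S)$ be its $\ell$-th largest singular value, counted with multiplicity. Then $p_h$ is square integrable for every $h>0$ (so that $T_h$ is well defined), and $$\sum_{\ell=1}^L\bigl(\sigma_\ell(T)-\sigma_\ell(T_h)\bigr)^2=O(h^4)\qquad (h\to 0^+).$$ -/

import Mathlib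

open MeasureTheory Filter Topology

namespace HMM

noncomputable section

/-! ### Integral operators on `L²` -/

section IntegralOperator

variable {α : Type*} [MeasurableSpace α] {μ : Measure α} [SFinite μ]

lemma lintegral_sq_integral_le {k : α × α → ℝ} (hk : MemLp k 2 (μ.prod μ))
    {ω : α → ℝ} (hω : MemLp ω 2 μ) :
    ∫⁻ y, ‖∫ x, ω x * k (x, y) ∂μ‖ₑ ^ (2 : ℝ) ∂μ ≤
      (eLpNorm ω 2 μ * eLpNorm k 2 (μ.prod μ)) ^ (2 : ℝ) := by
  have h2 : ∀ {β : Type _} [MeasurableSpace β] (ν : Measure β) (g : β → ℝ),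
      eLpNorm g 2 ν ^ (2 : ℝ) = ∫⁻ x, ‖g x‖ₑ ^ (2 : ℝ) ∂ν := by
    intro β _ ν g
    rw [eLpNorm_eq_lintegral_rpow_enorm_toReal (by norm_num) (by norm_num),
      ← ENNReal.rpow_mul]
    simp
  have hk1 := hk.aestronglyMeasurable.prod_swap
  have hk2 : ∀ᵐ y ∂μ, AEStronglyMeasurable (fun x => k (x, y)) μ := hk1.prodMk_left
  rw [ENNReal.mul_rpow_of_nonneg _ _ (by norm_num), h2, h2]
  rw [lintegral_prod_symm _ (hk.aestronglyMeasurable.enorm.pow_const _),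
    ← lintegral_const_mul' (∫⁻ x, ‖ω x‖ₑ ^ (2 : ℝ) ∂μ) _ (by
      rw [← h2]
      exact ENNReal.rpow_ne_top_of_nonneg (by norm_num) hω.eLpNorm_lt_top.ne)]
  refine lintegral_mono_ae ?_
  filter_upwards [hk2] with y hy
  calc ‖∫ x, ω x * k (x, y) ∂μ‖ₑ ^ (2 : ℝ)
      ≤ (∫⁻ x, ‖ω x * k (x, y)‖ₑ ∂μ) ^ (2 : ℝ) := by
        gcongr
        exact enorm_integral_le_lintegral_enorm _
    _ ≤ ((∫⁻ x, ‖ω x‖ₑ ^ (2 : ℝ) ∂μ) ^ (1 / (2 : ℝ)) *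
          (∫⁻ x, ‖k (x, y)‖ₑ ^ (2 : ℝ) ∂μ) ^ (1 / (2 : ℝ))) ^ (2 : ℝ) := by
        gcongr
        simp_rw [enorm_mul]
        exact ENNReal.lintegral_mul_le_Lp_mul_Lq μ Real.HolderConjugate.two_two
          hω.aestronglyMeasurable.enorm hy.enorm
    _ = _ := by
        rw [ENNReal.mul_rpow_of_nonneg _ _ (by norm_num), ← ENNReal.rpow_mul,
          ← ENNReal.rpow_mul]
        simp

lemma eLpNorm_integral_le {k : α × α → ℝ} (hk : MemLp k 2 (μ.prod μ))
    {ω : α → ℝ} (hω : MemLp ω 2 μ) :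
    eLpNorm (fun y => ∫ x, ω x * k (x, y) ∂μ) 2 μ ≤
      eLpNorm ω 2 μ * eLpNorm k 2 (μ.prod μ) := by
  rw [eLpNorm_eq_lintegral_rpow_enorm_toReal (by norm_num) (by norm_num)]
  have := ENNReal.rpow_le_rpow (lintegral_sq_integral_le hk hω)
    (show (0 : ℝ) ≤ 1 / 2 by norm_num)
  rw [← ENNReal.rpow_mul] at this
  simpa using this

lemma memLp_integral {k : α × α → ℝ} (hk : MemLp k 2 (μ.prod μ))
    {ω : α → ℝ} (hω : MemLp ω 2 μ) :
    MemLp (fun y => ∫ x, ω x * k (x, y) ∂μ) 2 μ := by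
  refine ⟨?_, (eLpNorm_integral_le hk hω).trans_lt
    (ENNReal.mul_lt_top hω.eLpNorm_lt_top hk.eLpNorm_lt_top)⟩
  have h1 : AEStronglyMeasurable (fun z : α × α => ω z.2 * k (z.2, z.1)) (μ.prod μ) :=
    hω.aestronglyMeasurable.comp_snd.mul hk.aestronglyMeasurable.prod_swap
  exact h1.integral_prod_right'

lemma ae_integrable_mul {k : α × α → ℝ} (hk : MemLp k 2 (μ.prod μ))
    {ω : α → ℝ} (hω : MemLp ω 2 μ) :
    ∀ᵐ y ∂μ, Integrable (fun x => ω x * k (x, y)) μ := by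
  have hk1 := hk.aestronglyMeasurable.prod_swap
  have hsq : Integrable (fun z : α × α => k z ^ 2) (μ.prod μ) := hk.integrable_sq
  have hk3 : ∀ᵐ y ∂μ, Integrable (fun x => k (x, y) ^ 2) μ :=
    (integrable_prod_iff' hsq.aestronglyMeasurable).1 hsq |>.1
  filter_upwards [hk1.prodMk_left, hk3] with y hy hy2
  exact hω.integrable_mul ((memLp_two_iff_integrable_sq hy).2 hy2)

/-- The integral operator `ω ↦ (y ↦ ∫ ω(x) k(x, y) dx)` on `L²(μ)` as a bounded operator, for a
square integrable function `k`. For a `k` that is not square integrable it is `0` by convention. -/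
def integralOperator (μ : Measure α) [SFinite μ] (k : α × α → ℝ) : Lp ℝ 2 μ →L[ℝ] Lp ℝ 2 μ :=
  open Classical in
  if hk : MemLp k 2 (μ.prod μ) then
    LinearMap.mkContinuous
      { toFun := fun ω => (memLp_integral hk (Lp.memLp ω)).toLp _
        map_add' := by
          intro ω η
          rw [← MemLp.toLp_add]
          refine MemLp.toLp_congr _ _ ?_
          filter_upwards [ae_integrable_mul hk (Lp.memLp ω), ae_integrable_mul hk (Lp.memLp η)]
            with y h1 h2
          rw [Pi.add_apply, ← integral_add h1 h2]
          refine integral_congr_ae ?_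
          filter_upwards [Lp.coeFn_add ω η] with x hx
          rw [hx, Pi.add_apply, add_mul]
        map_smul' := by
          intro c ω
          rw [RingHom.id_apply, ← MemLp.toLp_const_smul]
          refine MemLp.toLp_congr _ _ (Eventually.of_forall fun y => ?_)
          simp only [Pi.smul_apply, smul_eq_mul]
          rw [← integral_const_mul]
          refine integral_congr_ae ?_
          filter_upwards [Lp.coeFn_smul c ω] with x hx
          rw [hx, Pi.smul_apply, smul_eq_mul, mul_assoc] }
      (eLpNorm k 2 (μ.prod μ)).toReal
      (by
        intro ω
        simp only [LinearMap.coe_mk, AddHom.coe_mk, Lp.norm_toLp]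
        rw [mul_comm, Lp.norm_def, ← ENNReal.toReal_mul]
        exact ENNReal.toReal_mono
          (ENNReal.mul_lt_top (Lp.memLp ω).eLpNorm_lt_top hk.eLpNorm_lt_top).ne
          (eLpNorm_integral_le hk (Lp.memLp ω)))
  else 0

/-- The defining formula of the integral operator. -/
lemma integralOperator_apply {k : α × α → ℝ} (hk : MemLp k 2 (μ.prod μ)) (ω : Lp ℝ 2 μ) :
    integralOperator μ k ω =ᵐ[μ] fun y => ∫ x, ω x * k (x, y) ∂μ := by
  have : integralOperator μ k ω = (memLp_integral hk (Lp.memLp ω)).toLp _ := by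
    rw [integralOperator, dif_pos hk]; rfl
  rw [this]
  exact MemLp.coeFn_toLp _

end IntegralOperator

/-! ### Singular values -/

/-- The `j`-th largest singular value (`j = 1, 2, …`, counted with multiplicity) of a compact
operator `T` on a Hilbert space: singular values are the square roots of the eigenvalues of `T* T`,
and the `j`-th largest one is the largest `s ≥ 0` such that the eigenspaces of `T* T` for the
eigenvalues `≥ s²` have total dimension at least `j`. It is `0` when `T` has fewer than `j` non-zero
singular values. -/
def singularValue {H : Type*} [NormedAddCommGroup H] [InnerProductSpace ℝ H] [CompleteSpace H]
    (T : H →L[ℝ] H) (j : ℕ) : ℝ :=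
  sSup {s : ℝ | 0 ≤ s ∧ (j : Cardinal) ≤ Module.rank ℝ
    ↥(⨆ r ∈ Set.Ici (s ^ 2),
      Module.End.eigenspace ((ContinuousLinearMap.adjoint T ∘L T : H →L[ℝ] H) : H →ₗ[ℝ] H) r)}

/-! ### The hidden Markov model -/

/-- `A` is the transition matrix of a Markov chain on `L` states, of full rank, irreducible and
aperiodic (the return times to each state have greatest common divisor `1`), with stationary
distribution `w`. -/
structure IsRegularChain {L : ℕ} (A : Matrix (Fin L) (Fin L) ℝ) (w : Fin L → ℝ) : Prop where
  stochastic : A ∈ Matrix.rowStochastic ℝ (Fin L)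
  full_rank : A.rank = L
  irreducible : A.IsIrreducible
  aperiodic : ∀ i, ∀ m : ℕ, (∀ n : ℕ, 0 < n → 0 < (A ^ n) i i → m ∣ n) → m = 1
  prob : w ∈ stdSimplex ℝ (Fin L)
  stationary : Matrix.vecMul w A = w

/-- The `f ℓ` are probability densities on `ℝ^d`, linearly independent and square integrable. -/
structure IsEmissionFamily {d L : ℕ} (f : Fin L → (Fin d → ℝ) → ℝ) : Prop where
  measurable : ∀ ℓ, Measurable (f ℓ)
  nonneg : ∀ ℓ z, 0 ≤ f ℓ z
  integrable : ∀ ℓ, Integrable (f ℓ)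
  integral_eq_one : ∀ ℓ, ∫ z, f ℓ z = 1
  linearIndependent : LinearIndependent ℝ f
  square_integrable : ∀ ℓ, MemLp (f ℓ) 2

/-- The density `g_ℓ` of an observation given that the previous hidden state is `ℓ`. -/
def nextDensity {d L : ℕ} (A : Matrix (Fin L) (Fin L) ℝ) (f : Fin L → (Fin d → ℝ) → ℝ)
    (ℓ : Fin L) (y : Fin d → ℝ) : ℝ :=
  ∑ m, A ℓ m * f m y

/-- The density `p` of a pair of consecutive observations. -/
def pairDensity {d L : ℕ} (A : Matrix (Fin L) (Fin L) ℝ) (w : Fin L → ℝ)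
    (f : Fin L → (Fin d → ℝ) → ℝ) (y : (Fin d → ℝ) × (Fin d → ℝ)) : ℝ :=
  ∑ ℓ, w ℓ * f ℓ y.1 * nextDensity A f ℓ y.2

/-! ### The kernel and the smoothed density -/

/-- `K` is a univariate kernel (it integrates to `1`) that is in `L¹ ∩ L²`, has a Fourier transform
without zeros, a first moment equal to `0`, and a finite and positive second moment. -/
structure IsSmoothingKernel (K : ℝ → ℝ) : Prop where
  memLp_one : MemLp K 1
  memLp_two : MemLp K 2
  integral_eq_one : ∫ u, K u = 1
  fourier_ne_zero : ∀ ξ : ℝ, FourierTransform.fourier (fun u : ℝ => (K u : ℂ)) ξ ≠ 0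
  integrable_sq_mul : Integrable fun u => u ^ 2 * K u
  first_moment : ∫ u, u * K u = 0
  second_moment_pos : 0 < ∫ u, u ^ 2 * K u

/-- The product kernel `K_h^d(u) = ∏_j K(u_j / h) / h`. -/
def productKernel {d : ℕ} (K : ℝ → ℝ) (h : ℝ) (u : Fin d → ℝ) : ℝ :=
  ∏ j, K (u j / h) / h

/-- The smoothed function `p_h`, the convolution of `p` with `K_h^d ⊗ K_h^d`. -/
def smoothed {d : ℕ} (K : ℝ → ℝ) (h : ℝ) (p : (Fin d → ℝ) × (Fin d → ℝ) → ℝ)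
    (z : (Fin d → ℝ) × (Fin d → ℝ)) : ℝ :=
  ∫ y : (Fin d → ℝ) × (Fin d → ℝ),
    p y * productKernel K h (z.1 - y.1) * productKernel K h (z.2 - y.2)

/-! ### Regularity -/

/-- The coordinate directions of `ℝ^d × ℝ^d`. -/
def coordDir {d : ℕ} : Fin d ⊕ Fin d → (Fin d → ℝ) × (Fin d → ℝ)
  | Sum.inl i => (Pi.single i 1, 0)
  | Sum.inr i => (0, Pi.single i 1)

/-- `p` has, at every point, all (iterated, mixed) partial derivatives up to order `k`, and `p` and
all these partial derivatives are in `L¹ ∩ L²`. -/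
def HasIntegrablePartials {d : ℕ} : ℕ → ((Fin d → ℝ) × (Fin d → ℝ) → ℝ) → Prop
  | 0, p => MemLp p 1 ∧ MemLp p 2
  | k + 1, p => (MemLp p 1 ∧ MemLp p 2) ∧ ∀ i : Fin d ⊕ Fin d,
      (∀ z, LineDifferentiableAt ℝ p z (coordDir i)) ∧
        HasIntegrablePartials k fun z => lineDeriv ℝ p z (coordDir i)

/-! ### The two operators -/

/-- The integral operator `T` on `L²(ℝ^d)` with kernel function `p`. -/
def operatorT {d L : ℕ} (A : Matrix (Fin L) (Fin L) ℝ) (w : Fin L → ℝ)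
    (f : Fin L → (Fin d → ℝ) → ℝ) :
    Lp ℝ 2 (volume : Measure (Fin d → ℝ)) →L[ℝ] Lp ℝ 2 (volume : Measure (Fin d → ℝ)) :=
  integralOperator volume (pairDensity A w f)

/-- The smoothed integral operator `T_h` on `L²(ℝ^d)` with kernel function `p_h`. -/
def operatorTh {d L : ℕ} (A : Matrix (Fin L) (Fin L) ℝ) (w : Fin L → ℝ)
    (f : Fin L → (Fin d → ℝ) → ℝ) (K : ℝ → ℝ) (h : ℝ) :
    Lp ℝ 2 (volume : Measure (Fin d → ℝ)) →L[ℝ] Lp ℝ 2 (volume : Measure (Fin d → ℝ)) :=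
  integralOperator volume (smoothed K h (pairDensity A w f))

end

end HMM

/-! Weyl's inequality `abs_singularValue_sub_le` bounds each |σ_ℓ(T) − σ_ℓ(T_h)| by ‖T − T_h‖. This
operator norm is at most the Hilbert–Schmidt norm ‖p − p_h‖ in L² (`norm_integralOperator_sub_le`),
so everything reduces to an L² smoothing bias of order h².

Weyl's inequality rests on the spectral theorem for T*T and so needs compact operators. Here both
have finite rank: p is a sum of L products, and smoothing acts on each factor separately
(`smoothed_sum_mul_ae_eq`).

For the bias (`exists_eLpNorm_smoothed_sub_le`), p_h averages translates of p over 2d coordinate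
shifts, which are switched on one at a time. Each switch is expanded by Taylor's formula along a
line. The linear term vanishes because K has zero first moment. The remainder is a weighted average
of translates of a pure second derivative, and Young's inequality bounds its L² norm by the L¹ norm
of the weight, which scales as h². Third derivatives make the second ones continuous along lines, as
the integral remainder requires. -/

namespace HMM

/-! ### Weyl's inequality for singular values -/

section SingularValues

open Module.End

variable {H : Type*} [NormedAddCommGroup H] [InnerProductSpace ℝ H]

lemma exists_finsupp_of_mem_biSup_eigenspace {B : H →ₗ[ℝ] H} {S : Set ℝ} {x : H}
    (hx : x ∈ ⨆ r ∈ S, eigenspace B r) :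
    ∃ f : ℝ →₀ H, (∀ r, f r ∈ eigenspace B r) ∧ (∀ r ∈ f.support, r ∈ S) ∧
      ∑ r ∈ f.support, f r = x := by
  obtain ⟨f, hf, hsum⟩ := (Submodule.mem_iSup_iff_exists_finsupp _ _).1 hx
  have hS : ∀ r ∉ S, f r = 0 := fun r hr => by simpa [hr] using hf r
  refine ⟨f, fun r => ?_, fun r hr => ?_, hsum⟩
  · by_cases hr : r ∈ S
    · simpa [hr] using hf r
    · simp [hS r hr]
  · by_contra h
    exact Finsupp.mem_support_iff.1 hr (hS r h)

/-- Eigenspaces of a symmetric operator are mutually orthogonal, so Pythagoras applies to finite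
sums of eigenvectors. -/
lemma norm_sq_and_inner_eq_sum {B : H →ₗ[ℝ] H} (hB : B.IsSymmetric) {f : ℝ →₀ H}
    (hf : ∀ r, f r ∈ eigenspace B r) :
    ‖∑ r ∈ f.support, f r‖ ^ 2 = ∑ r ∈ f.support, ‖f r‖ ^ 2 ∧
      inner ℝ (B (∑ r ∈ f.support, f r)) (∑ r ∈ f.support, f r) =
        ∑ r ∈ f.support, r * ‖f r‖ ^ 2 := by
  have hV := hB.orthogonalFamily_eigenspaces
  constructor
  · simpa using hV.norm_sum (fun r => ⟨f r, hf r⟩) f.support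
  · have h := hV.inner_sum (fun r => r • ⟨f r, hf r⟩) (fun r => ⟨f r, hf r⟩) f.support
    have hBf : B (∑ r ∈ f.support, f r) = ∑ r ∈ f.support, r • f r := by
      rw [map_sum]
      exact Finset.sum_congr rfl fun r _ => mem_eigenspace_iff.1 (hf r)
    rw [hBf]
    simpa [inner_smul_left, real_inner_self_eq_norm_sq] using h

/-- The orthogonal projection of `V` to `W` cannot be injective; a nonzero kernel vector is the one
sought. This is the dimension count behind the min-max principle. -/
lemma exists_mem_mem_orthogonal_of_rank_lt {V W : Submodule ℝ H} {j : ℕ}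
    (hV : (j : Cardinal) ≤ Module.rank ℝ V) (hW : Module.rank ℝ W < j) :
    ∃ x ∈ V, x ∈ Wᗮ ∧ x ≠ 0 := by
  have hfin : FiniteDimensional ℝ W :=
    Module.rank_lt_aleph0_iff.1 (hW.trans (Cardinal.natCast_lt_aleph0))
  let P : V →ₗ[ℝ] W := (W.orthogonalProjectionOnto : H →ₗ[ℝ] W) ∘ₗ V.subtype
  have hP : ¬ Function.Injective P := fun h =>
    absurd (hV.trans (LinearMap.rank_le_of_injective P h)) (not_le.2 hW)
  rw [← LinearMap.ker_eq_bot, Submodule.eq_bot_iff] at hP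
  push Not at hP
  obtain ⟨x, hx, hx0⟩ := hP
  refine ⟨x, x.2, ?_, by simpa using hx0⟩
  simpa [P, Submodule.orthogonalProjectionOnto_eq_zero_iff] using hx

variable [CompleteSpace H]

/-- The sum of the eigenspaces of `T* T` for eigenvalues in `S`. -/
noncomputable def spectralSubspace (T : H →L[ℝ] H) (S : Set ℝ) : Submodule ℝ H :=
  ⨆ r ∈ S, eigenspace ((ContinuousLinearMap.adjoint T ∘L T : H →L[ℝ] H) : H →ₗ[ℝ] H) r

lemma eigenspace_le_spectralSubspace (T : H →L[ℝ] H) {S : Set ℝ} {r : ℝ} (hr : r ∈ S) :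
    eigenspace ((ContinuousLinearMap.adjoint T ∘L T : H →L[ℝ] H) : H →ₗ[ℝ] H) r ≤
      spectralSubspace T S :=
  le_biSup (fun r => eigenspace
    ((ContinuousLinearMap.adjoint T ∘L T : H →L[ℝ] H) : H →ₗ[ℝ] H) r) hr

lemma isSymmetric_adjoint_comp_self (T : H →L[ℝ] H) :
    ((ContinuousLinearMap.adjoint T ∘L T : H →L[ℝ] H) : H →ₗ[ℝ] H).IsSymmetric := by
  intro x y
  simp [ContinuousLinearMap.adjoint_inner_left, ContinuousLinearMap.adjoint_inner_right]

lemma inner_adjoint_comp_self (T : H →L[ℝ] H) (x : H) :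
    inner ℝ (((ContinuousLinearMap.adjoint T ∘L T : H →L[ℝ] H) : H →ₗ[ℝ] H) x) x = ‖T x‖ ^ 2 := by
  simp [ContinuousLinearMap.adjoint_inner_left]

lemma mul_norm_le_norm_apply {T : H →L[ℝ] H} {s : ℝ} {x : H}
    (hx : x ∈ spectralSubspace T (Set.Ici (s ^ 2))) : s * ‖x‖ ≤ ‖T x‖ := by
  obtain ⟨f, hf, hfS, rfl⟩ := exists_finsupp_of_mem_biSup_eigenspace hx
  obtain ⟨h1, h2⟩ := norm_sq_and_inner_eq_sum (isSymmetric_adjoint_comp_self T) hf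
  rw [inner_adjoint_comp_self] at h2
  refine le_of_sq_le_sq ?_ (norm_nonneg _)
  rw [mul_pow, h1, h2, Finset.mul_sum]
  exact Finset.sum_le_sum fun r hr => mul_le_mul_of_nonneg_right (hfS r hr) (sq_nonneg _)

lemma norm_apply_le_mul_norm {T : H →L[ℝ] H} {s : ℝ} (hs : 0 ≤ s) {x : H}
    (hx : x ∈ spectralSubspace T (Set.Iio (s ^ 2))) : ‖T x‖ ≤ s * ‖x‖ := by
  obtain ⟨f, hf, hfS, rfl⟩ := exists_finsupp_of_mem_biSup_eigenspace hx
  obtain ⟨h1, h2⟩ := norm_sq_and_inner_eq_sum (isSymmetric_adjoint_comp_self T) hf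
  rw [inner_adjoint_comp_self] at h2
  refine le_of_sq_le_sq ?_ (by positivity)
  rw [mul_pow, h1, h2, Finset.mul_sum]
  exact Finset.sum_le_sum fun r hr => mul_le_mul_of_nonneg_right (hfS r hr).le (sq_nonneg _)

lemma spectralSubspace_isOrtho (T : H →L[ℝ] H) {S S' : Set ℝ} (h : Disjoint S S') :
    spectralSubspace T S ⟂ spectralSubspace T S' := by
  simp only [spectralSubspace, Submodule.isOrtho_iSup_left, Submodule.isOrtho_iSup_right]
  intro r hr r' hr'
  exact (isSymmetric_adjoint_comp_self T).orthogonalFamily_eigenspaces.isOrtho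
    fun h' => (Set.disjoint_left.1 h hr') (h' ▸ hr)

/-- Compactness makes the eigenspaces of T*T span a dense subspace. A vector orthogonal to those
with eigenvalue ≥ s² is therefore a limit of sums of eigenvectors with eigenvalue < s², and the
bound passes to the limit. -/
lemma norm_apply_le_of_mem_orthogonal {T : H →L[ℝ] H} (hT : IsCompactOperator T) {s : ℝ}
    (hs : 0 ≤ s) {x : H} (hx : x ∈ (spectralSubspace T (Set.Ici (s ^ 2)))ᗮ) :
    ‖T x‖ ≤ s * ‖x‖ := by
  set M := (spectralSubspace T (Set.Iio (s ^ 2))).topologicalClosure with hM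
  have hMc : IsClosed (M : Set H) := Submodule.isClosed_topologicalClosure _
  have : CompleteSpace M := hMc.completeSpace_coe
  have hMle : M ≤ (spectralSubspace T (Set.Ici (s ^ 2)))ᗮ :=
    Submodule.topologicalClosure_minimal _
      (spectralSubspace_isOrtho T (Set.disjoint_left.2 fun r h1 h2 => not_le.2 (Set.mem_Iio.1 h1) h2))
      (Submodule.isClosed_orthogonal _)
  have hxM : x ∈ M := by
    -- The component `n` off `M` is orthogonal to small eigenspaces by choice and to large ones
    -- because `x` and `m` are, hence it is zero.
    obtain ⟨m, hm, n, hn, rfl⟩ := M.exists_add_mem_mem_orthogonal x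
    have hn' : n ∈ (spectralSubspace T (Set.Ici (s ^ 2)))ᗮ := by
      simpa using Submodule.sub_mem _ hx (hMle hm)
    have hbot : n ∈ (⨆ r, eigenspace
        ((ContinuousLinearMap.adjoint T ∘L T : H →L[ℝ] H) : H →ₗ[ℝ] H) r)ᗮ := by
      rw [← Submodule.iInf_orthogonal, Submodule.mem_iInf]
      intro r
      rcases lt_or_ge r (s ^ 2) with hr | hr
      · refine Submodule.orthogonal_le ?_ hn
        exact (eigenspace_le_spectralSubspace T (Set.mem_Iio.2 hr)).trans
          (Submodule.le_topologicalClosure _)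
      · exact Submodule.orthogonal_le (eigenspace_le_spectralSubspace T (Set.mem_Ici.2 hr)) hn'
    rw [ContinuousLinearMap.orthogonalComplement_iSup_eigenspaces_eq_bot
      (T := ContinuousLinearMap.adjoint T ∘L T) (hT.clm_comp (ContinuousLinearMap.adjoint T))
      (isSymmetric_adjoint_comp_self T), Submodule.mem_bot] at hbot
    simpa [hbot] using hm
  have hcl : IsClosed {x : H | ‖T x‖ ≤ s * ‖x‖} := isClosed_le (by fun_prop) (by fun_prop)
  exact closure_minimal (fun y hy => norm_apply_le_mul_norm hs hy) hcl hxM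

lemma singularValue_nonneg (T : H →L[ℝ] H) (j : ℕ) : 0 ≤ singularValue T j :=
  Real.sSup_nonneg fun _ hs => hs.1

/-- The supremum is over a set bounded by ‖T‖, since a nonzero vector of the spectral subspace is
stretched by at least s. For j = 0 the set is unbounded and `sSup` defaults to 0, hence `1 ≤ j`. -/
lemma le_singularValue {T : H →L[ℝ] H} {j : ℕ} (hj : 1 ≤ j) {s : ℝ} (hs : 0 ≤ s)
    (h : (j : Cardinal) ≤ Module.rank ℝ (spectralSubspace T (Set.Ici (s ^ 2)))) :
    s ≤ singularValue T j := by
  refine le_csSup ⟨‖T‖, ?_⟩ ⟨hs, h⟩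
  rintro t ⟨ht, htj⟩
  obtain ⟨x, hx, -, hx0⟩ := exists_mem_mem_orthogonal_of_rank_lt (W := ⊥) htj
    (by simpa using Nat.pos_of_ne_zero (by omega))
  exact le_of_mul_le_mul_right ((mul_norm_le_norm_apply hx).trans (T.le_opNorm x))
    (norm_pos_iff.2 hx0)

/-- Min-max argument: a space of dimension at least j on which T stretches by at least s contains a
nonzero vector on which S stretches by at most t, for any t above σ_j(S). The triangle inequality
then gives s ≤ t + ‖T − S‖. -/
lemma singularValue_le_add {T S : H →L[ℝ] H} (hS : IsCompactOperator S) {j : ℕ} (hj : 1 ≤ j) :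
    singularValue T j ≤ singularValue S j + ‖T - S‖ := by
  refine Real.sSup_le ?_ (add_nonneg (singularValue_nonneg _ _) (norm_nonneg _))
  rintro s ⟨hs, hsj⟩
  refine le_of_forall_pos_lt_add fun ε hε => ?_
  by_contra! hlt
  -- Half of ε keeps `t` strictly above σ_j(S); the other half contradicts s ≤ ‖T − S‖ + t.
  set t := s - ‖T - S‖ - ε / 2 with ht
  have ht0 : 0 ≤ t := by linarith [singularValue_nonneg S j]
  have htj : Module.rank ℝ (spectralSubspace S (Set.Ici (t ^ 2))) < j := by
    by_contra! h
    linarith [le_singularValue hj ht0 h]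
  obtain ⟨x, hxT, hxS, hx0⟩ := exists_mem_mem_orthogonal_of_rank_lt hsj htj
  have h1 := mul_norm_le_norm_apply hxT
  have h2 := norm_apply_le_of_mem_orthogonal hS ht0 hxS
  have h3 : ‖T x‖ ≤ ‖T - S‖ * ‖x‖ + ‖S x‖ :=
    calc ‖T x‖ = ‖(T - S) x + S x‖ := by simp
      _ ≤ _ := (norm_add_le _ _).trans (by gcongr; exact (T - S).le_opNorm x)
  have h4 : 0 < ‖x‖ := norm_pos_iff.2 hx0
  have : s * ‖x‖ ≤ (‖T - S‖ + t) * ‖x‖ := by linarith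
  have := le_of_mul_le_mul_right this h4
  linarith

/-- **Weyl's inequality** for the singular values of compact operators. -/
lemma abs_singularValue_sub_le {T S : H →L[ℝ] H} (hT : IsCompactOperator T)
    (hS : IsCompactOperator S) {j : ℕ} (hj : 1 ≤ j) :
    |singularValue T j - singularValue S j| ≤ ‖T - S‖ := by
  have h1 := singularValue_le_add (T := T) hS hj
  have h2 := singularValue_le_add (T := S) hT hj
  rw [norm_sub_rev] at h2
  exact abs_sub_le_iff.2 ⟨by linarith, by linarith⟩

end SingularValues

/-! ### Norm bound and compactness for integral operators -/

section IntegralOperatorProperties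

variable {α : Type*} [MeasurableSpace α] {μ : Measure α}

lemma memLp_mul_prod {a b : α → ℝ} (ha : MemLp a 2 μ) (hb : MemLp b 2 μ) :
    MemLp (fun z : α × α => a z.1 * b z.2) 2 (μ.prod μ) := by
  refine (memLp_two_iff_integrable_sq
    (ha.aestronglyMeasurable.comp_fst.mul hb.aestronglyMeasurable.comp_snd)).2 ?_
  simpa only [mul_pow, Pi.mul_apply] using ha.integrable_sq.mul_prod hb.integrable_sq

variable [SFinite μ]

lemma norm_integralOperator_sub_le {k l : α × α → ℝ} (hk : MemLp k 2 (μ.prod μ))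
    (hl : MemLp l 2 (μ.prod μ)) :
    ‖integralOperator μ k - integralOperator μ l‖ ≤
      (eLpNorm (fun z => k z - l z) 2 (μ.prod μ)).toReal := by
  refine ContinuousLinearMap.opNorm_le_bound _ ENNReal.toReal_nonneg fun ω => ?_
  have hkl : MemLp (fun z => k z - l z) 2 (μ.prod μ) := hk.sub hl
  have h : (integralOperator μ k - integralOperator μ l) ω =ᵐ[μ]
      fun y => ∫ x, ω x * (k (x, y) - l (x, y)) ∂μ := by
    rw [sub_apply]
    filter_upwards [Lp.coeFn_sub (integralOperator μ k ω) (integralOperator μ l ω),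
      integralOperator_apply hk ω, integralOperator_apply hl ω,
      ae_integrable_mul hk (Lp.memLp ω), ae_integrable_mul hl (Lp.memLp ω)] with y h1 h2 h3 h4 h5
    rw [h1, Pi.sub_apply, h2, h3, ← integral_sub h4 h5]
    simp_rw [mul_sub]
  rw [Lp.norm_def, Lp.norm_def, eLpNorm_congr_ae h, mul_comm, ← ENNReal.toReal_mul]
  exact ENNReal.toReal_mono
    (ENNReal.mul_lt_top (Lp.memLp ω).eLpNorm_lt_top hkl.eLpNorm_lt_top).ne
    (eLpNorm_integral_le hkl (Lp.memLp ω))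

/-- Needed because the smoothed density factors only almost everywhere. -/
lemma integralOperator_congr_ae {k l : α × α → ℝ} (hk : MemLp k 2 (μ.prod μ))
    (h : k =ᵐ[μ.prod μ] l) : integralOperator μ k = integralOperator μ l := by
  have h1 := norm_integralOperator_sub_le hk (hk.ae_eq h)
  have h2 : eLpNorm (fun z => k z - l z) 2 (μ.prod μ) = 0 := by
    rw [eLpNorm_congr_ae (g := fun _ => 0) (by filter_upwards [h] with z hz; simp [hz])]
    simp
  rw [h2, ENNReal.toReal_zero] at h1
  exact sub_eq_zero.1 (norm_le_zero_iff.1 h1)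

/-- An integral operator whose kernel function is a finite sum of products is compact. -/
lemma isCompactOperator_integralOperator {ι : Type*} (s : Finset ι) {a b : ι → α → ℝ}
    (ha : ∀ i, MemLp (a i) 2 μ) (hb : ∀ i, MemLp (b i) 2 μ) {k : α × α → ℝ}
    (hk : k =ᵐ[μ.prod μ] fun z => ∑ i ∈ s, a i z.1 * b i z.2) :
    IsCompactOperator (integralOperator μ k) := by
  have hk2 : MemLp (fun z : α × α => ∑ i ∈ s, a i z.1 * b i z.2) 2 (μ.prod μ) :=
    memLp_finsetSum s fun i _ => memLp_mul_prod (ha i) (hb i)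
  rw [← integralOperator_congr_ae hk2 hk.symm]
  -- Each product a(x)b(y) gives the rank-one operator ω ↦ ⟨a, ω⟩ b.
  have hT : integralOperator μ (fun z : α × α => ∑ i ∈ s, a i z.1 * b i z.2) =
      ∑ i ∈ s, (ContinuousLinearMap.toSpanSingleton ℝ (hb i).toLp) ∘L
        (innerSL ℝ (ha i).toLp) := by
    ext1 ω
    refine Lp.ext ?_
    have hω : ∀ i, ∀ᵐ y ∂μ, (((ContinuousLinearMap.toSpanSingleton ℝ (hb i).toLp) ∘L
        (innerSL ℝ (ha i).toLp)) ω) y = ∫ x, ω x * (a i x * b i y) ∂μ := by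
      intro i
      filter_upwards [(hb i).coeFn_toLp, Lp.coeFn_smul (inner ℝ (ha i).toLp ω) (hb i).toLp]
        with y h1 h2
      rw [ContinuousLinearMap.comp_apply, ContinuousLinearMap.toSpanSingleton_apply,
        innerSL_apply_apply, h2, Pi.smul_apply, h1, L2.inner_def, smul_eq_mul,
        ← integral_mul_const]
      refine integral_congr_ae ?_
      filter_upwards [(ha i).coeFn_toLp] with x hx
      simp [hx, mul_assoc]
    have hint : ∀ i, ∀ᵐ y ∂μ, Integrable (fun x => ω x * (a i x * b i y)) μ := fun i =>
      ae_integrable_mul (memLp_mul_prod (ha i) (hb i)) (Lp.memLp ω)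
    rw [sum_apply]
    filter_upwards [integralOperator_apply hk2 ω, Lp.coeFn_finsetSum s fun i =>
      ((ContinuousLinearMap.toSpanSingleton ℝ (hb i).toLp) ∘L (innerSL ℝ (ha i).toLp)) ω,
      (ae_ball_iff s.countable_toSet).2 fun i _ => hω i,
      (ae_ball_iff s.countable_toSet).2 fun i _ => hint i] with y h1 h2 h3 h4
    rw [h1, h2, Finset.sum_apply]
    simp_rw [Finset.mul_sum]
    rw [integral_finsetSum _ h4]
    exact Finset.sum_congr rfl fun i hi => (h3 i hi).symm
  rw [hT]
  have hmem : ∀ i ∈ s, (ContinuousLinearMap.toSpanSingleton ℝ (hb i).toLp) ∘L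
      (innerSL ℝ (ha i).toLp) ∈ compactOperator (RingHom.id ℝ) (Lp ℝ 2 μ) (Lp ℝ 2 μ) := fun i _ =>
    IsCompactOperator.clm_comp (f := innerSL ℝ (ha i).toLp)
      (isCompactOperator_of_locallyCompactSpace_dom _)
      (ContinuousLinearMap.toSpanSingleton ℝ (hb i).toLp)
  exact Submodule.sum_mem _ hmem

end IntegralOperatorProperties

/-! ### Young's inequality for weighted averages of translates -/

section WeightedTranslates

variable {E U : Type*} [MeasurableSpace E] [AddCommGroup E] [MeasurableSub₂ E]
  {μ : Measure E} [MeasurableSpace U] {ν : Measure U} [SFinite ν]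

lemma aestronglyMeasurable_integral_mul_translate {k : U → ℝ} (hk : Integrable k ν) {τ : U → E}
    (hτ : Measurable τ) {g : E → ℝ} (hg : Measurable g) :
    AEStronglyMeasurable (fun z => ∫ u, k u * g (z - τ u) ∂ν) μ := by
  have hgm : Measurable fun q : E × U => g (q.1 - τ q.2) := by fun_prop
  exact AEStronglyMeasurable.integral_prod_right'
    (f := fun q : E × U => k q.2 * g (q.1 - τ q.2))
    (hk.aestronglyMeasurable.comp_snd.mul hgm.aestronglyMeasurable)

variable [MeasurableAdd₂ E] [SFinite μ] [μ.IsAddRightInvariant]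

/-- Write |k| = |k|^{1/2}·|k|^{1/2} and apply Cauchy–Schwarz in u; then Tonelli and translation
invariance finish. The shift is an arbitrary measurable `τ` on a parameter space so that Taylor
remainders, with their extra variable, are covered. -/
lemma lintegral_sq_lintegral_translate_le {k : U → ℝ} (hk : Integrable k ν) {τ : U → E}
    (hτ : Measurable τ) {g : E → ℝ} (hg : Measurable g) :
    ∫⁻ z, (∫⁻ u, ‖k u * g (z - τ u)‖ₑ ∂ν) ^ (2 : ℝ) ∂μ ≤
      ((∫⁻ u, ‖k u‖ₑ ∂ν) * eLpNorm g 2 μ) ^ (2 : ℝ) := by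
  have h2 : eLpNorm g 2 μ ^ (2 : ℝ) = ∫⁻ x, ‖g x‖ₑ ^ (2 : ℝ) ∂μ := by
    rw [eLpNorm_eq_lintegral_rpow_enorm_toReal (by norm_num) (by norm_num),
      ← ENNReal.rpow_mul]
    simp
  have hgm : Measurable fun q : E × U => g (q.1 - τ q.2) := by fun_prop
  have hgz : ∀ z, Measurable fun u => g (z - τ u) := fun z => by fun_prop
  have hke : AEMeasurable (fun u => ‖k u‖ₑ) ν := hk.aestronglyMeasurable.enorm
  have hsplit : ∀ a b : ENNReal, a * b = a ^ (1 / (2 : ℝ)) * (a ^ (1 / (2 : ℝ)) * b) := by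
    intro a b
    rw [← mul_assoc, ← ENNReal.rpow_add_of_nonneg _ _ (by norm_num) (by norm_num)]
    norm_num
  have hroot : ∀ a : ENNReal, (a ^ (1 / (2 : ℝ))) ^ (2 : ℝ) = a := by
    intro a
    rw [← ENNReal.rpow_mul]
    norm_num
  have key : ∀ z, (∫⁻ u, ‖k u * g (z - τ u)‖ₑ ∂ν) ^ (2 : ℝ) ≤
      (∫⁻ u, ‖k u‖ₑ ∂ν) * ∫⁻ u, ‖k u‖ₑ * ‖g (z - τ u)‖ₑ ^ (2 : ℝ) ∂ν := by
    intro z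
    have := ENNReal.lintegral_mul_le_Lp_mul_Lq ν Real.HolderConjugate.two_two
      (hke.pow_const (1 / (2 : ℝ)))
      ((hke.pow_const (1 / (2 : ℝ))).mul (hgz z).enorm.aemeasurable)
    have h3 := ENNReal.rpow_le_rpow this (show (0 : ℝ) ≤ 2 by norm_num)
    rw [ENNReal.mul_rpow_of_nonneg _ _ (by norm_num), hroot, hroot] at h3
    simp only [Pi.mul_apply, hroot, ← hsplit,
      ENNReal.mul_rpow_of_nonneg _ _ (show (0 : ℝ) ≤ 2 by norm_num)] at h3
    simpa only [enorm_mul] using h3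
  calc _ ≤ ∫⁻ z, (∫⁻ u, ‖k u‖ₑ ∂ν) * ∫⁻ u, ‖k u‖ₑ * ‖g (z - τ u)‖ₑ ^ (2 : ℝ) ∂ν ∂μ :=
        lintegral_mono key
    _ = (∫⁻ u, ‖k u‖ₑ ∂ν) * ∫⁻ u, ‖k u‖ₑ * ∫⁻ z, ‖g (z - τ u)‖ₑ ^ (2 : ℝ) ∂μ ∂ν := by
        rw [lintegral_const_mul' _ _ hk.2.ne, lintegral_lintegral_swap]
        · congr 1
          refine lintegral_congr fun u => ?_
          rw [lintegral_const_mul' _ _ (by simp)]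
        · exact (hke.comp_snd).mul (hgm.enorm.pow_const _).aemeasurable
    _ = _ := by
        simp_rw [lintegral_sub_right_eq_self (μ := μ) (fun z => ‖g z‖ₑ ^ (2 : ℝ)), ← h2]
        rw [lintegral_mul_const'' _ hke, ← mul_assoc, ENNReal.mul_rpow_of_nonneg _ _ (by norm_num)]
        norm_num [pow_two]

lemma ae_integrable_mul_translate {k : U → ℝ} (hk : Integrable k ν) {τ : U → E}
    (hτ : Measurable τ) {g : E → ℝ} (hg : Measurable g) (hg2 : MemLp g 2 μ) :
    ∀ᵐ z ∂μ, Integrable (fun u => k u * g (z - τ u)) ν := by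
  have hgm : Measurable fun q : E × U => g (q.1 - τ q.2) := by fun_prop
  have hlt := (lintegral_sq_lintegral_translate_le (μ := μ) hk hτ hg).trans_lt
    (ENNReal.rpow_lt_top_of_nonneg (by norm_num) (ENNReal.mul_lt_top hk.2 hg2.2).ne)
  have hm : AEMeasurable (fun z => (∫⁻ u, ‖k u * g (z - τ u)‖ₑ ∂ν) ^ (2 : ℝ)) μ :=
    AEMeasurable.pow_const (AEMeasurable.lintegral_prod_right'
      (f := fun q : E × U => ‖k q.2 * g (q.1 - τ q.2)‖ₑ)
      (hk.aestronglyMeasurable.comp_snd.mul hgm.aestronglyMeasurable).enorm) _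
  filter_upwards [ae_lt_top' hm hlt.ne] with z hz
  refine ⟨hk.aestronglyMeasurable.mul
    (hg.comp (measurable_const.sub hτ)).aestronglyMeasurable, ?_⟩
  exact (ENNReal.rpow_lt_top_iff_of_pos (by norm_num)).1 hz

lemma eLpNorm_integral_mul_translate_le {k : U → ℝ} (hk : Integrable k ν) {τ : U → E}
    (hτ : Measurable τ) {g : E → ℝ} (hg : Measurable g) :
    eLpNorm (fun z => ∫ u, k u * g (z - τ u) ∂ν) 2 μ ≤
      (∫⁻ u, ‖k u‖ₑ ∂ν) * eLpNorm g 2 μ := by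
  rw [eLpNorm_eq_lintegral_rpow_enorm_toReal (by norm_num) (by norm_num)]
  have h1 : ∫⁻ z, ‖∫ u, k u * g (z - τ u) ∂ν‖ₑ ^ (2 : ℝ) ∂μ ≤ _ :=
    (lintegral_mono fun z => ENNReal.rpow_le_rpow (enorm_integral_le_lintegral_enorm _)
      (by norm_num)).trans (lintegral_sq_lintegral_translate_le hk hτ hg)
  have := ENNReal.rpow_le_rpow h1 (show (0 : ℝ) ≤ 1 / 2 by norm_num)
  rw [← ENNReal.rpow_mul _ 2] at this
  simpa using this

lemma memLp_integral_mul_translate {k : U → ℝ} (hk : Integrable k ν) {τ : U → E}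
    (hτ : Measurable τ) {g : E → ℝ} (hg : Measurable g) (hg2 : MemLp g 2 μ) :
    MemLp (fun z => ∫ u, k u * g (z - τ u) ∂ν) 2 μ :=
  ⟨aestronglyMeasurable_integral_mul_translate hk hτ hg,
    (eLpNorm_integral_mul_translate_le hk hτ hg).trans_lt (ENNReal.mul_lt_top hk.2 hg2.2)⟩

end WeightedTranslates

/-! ### Calculus along lines -/

section LineDerivatives

variable {E : Type*} [NormedAddCommGroup E] [NormedSpace ℝ E]

lemma hasDerivAt_comp_line {g : E → ℝ} {v : E} (hd : ∀ z, LineDifferentiableAt ℝ g z v)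
    (z : E) (r : ℝ) : HasDerivAt (fun r : ℝ => g (z + r • v)) (lineDeriv ℝ g (z + r • v) v) r := by
  have h : HasDerivAt (fun t : ℝ => g (z + r • v + t • v)) (lineDeriv ℝ g (z + r • v) v) (r - r) := by
    rw [sub_self]
    exact (hd (z + r • v)).hasLineDerivAt
  have := h.comp_sub_const r r
  simpa only [add_assoc, ← add_smul, add_sub_cancel] using this

lemma continuous_comp_line {g : E → ℝ} {v : E} (hd : ∀ z, LineDifferentiableAt ℝ g z v) (z : E) :
    Continuous fun r : ℝ => g (z + r • v) :=
  continuous_iff_continuousAt.2 fun r => (hasDerivAt_comp_line hd z r).continuousAt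

lemma measurable_lineDeriv_of_lineDifferentiableAt [MeasurableSpace E] [BorelSpace E]
    {g : E → ℝ} (hg : Measurable g) {v : E} (hd : ∀ z, LineDifferentiableAt ℝ g z v) :
    Measurable fun z => lineDeriv ℝ g z v := by
  have hlim : Tendsto (fun n : ℕ => 1 / ((n : ℝ) + 1)) atTop (𝓝[>] 0) :=
    tendsto_nhdsWithin_iff.2 ⟨tendsto_one_div_add_atTop_nhds_zero_nat,
      Eventually.of_forall fun n => Set.mem_Ioi.2 Nat.one_div_pos_of_nat⟩
  refine measurable_of_tendsto_metrizable
    (f := fun (n : ℕ) z => (1 / ((n : ℝ) + 1))⁻¹ • (g (z + (1 / ((n : ℝ) + 1)) • v) - g z))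
    (fun n => ?_) (tendsto_pi_nhds.2 fun z =>
      ((hd z).hasLineDerivAt.tendsto_slope_zero_right).comp hlim)
  exact ((hg.comp (measurable_id.add_const _)).sub hg).const_mul _

/-- Taylor's formula of order two along a line, with integral remainder. -/
lemma eq_add_integral_of_lineDifferentiableAt {g : E → ℝ} {v : E}
    (hd : ∀ z, LineDifferentiableAt ℝ g z v)
    (hd1 : ∀ z, LineDifferentiableAt ℝ (fun z => lineDeriv ℝ g z v) z v)
    (hc : ∀ z, Continuous fun r : ℝ => lineDeriv ℝ (fun z => lineDeriv ℝ g z v) (z + r • v) v)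
    (z : E) (t : ℝ) :
    g (z - t • v) = g z - t * lineDeriv ℝ g z v + t ^ 2 * ∫ s in (0 : ℝ)..1,
      (1 - s) * lineDeriv ℝ (fun z => lineDeriv ℝ g z v) (z - (s * t) • v) v := by
  set g1 := fun z => lineDeriv ℝ g z v with hg1
  set g2 := fun z => lineDeriv ℝ g1 z v with hg2
  have hlin : ∀ s : ℝ, HasDerivAt (fun s : ℝ => -(s * t)) (-t) s := fun s => by
    simpa using ((hasDerivAt_id s).mul_const t).fun_neg
  have hline : ∀ s : ℝ, z - (s * t) • v = z + (-(s * t)) • v := fun s => by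
    rw [neg_smul, sub_eq_add_neg]
  have h0 : ∀ s : ℝ, HasDerivAt (fun s : ℝ => g (z - (s * t) • v))
      (g1 (z - (s * t) • v) * -t) s := fun s => by
    simp_rw [hline]
    exact (hasDerivAt_comp_line hd z (-(s * t))).comp s (hlin s)
  have h1 : ∀ s : ℝ, HasDerivAt (fun s : ℝ => g1 (z - (s * t) • v))
      (g2 (z - (s * t) • v) * -t) s := fun s => by
    simp_rw [hline]
    exact (hasDerivAt_comp_line hd1 z (-(s * t))).comp s (hlin s)
  -- In the derivative of this function the first-order terms cancel, and its increment over [0, 1]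
  -- is the Taylor remainder.
  have hF : ∀ s ∈ Set.uIcc (0 : ℝ) 1, HasDerivAt
      (fun s : ℝ => g (z - (s * t) • v) + (1 - s) * (-t * g1 (z - (s * t) • v)))
      (t ^ 2 * ((1 - s) * g2 (z - (s * t) • v))) s := fun s _ => by
    refine ((h0 s).fun_add (((hasDerivAt_id' s).const_sub 1).fun_mul
      ((h1 s).const_mul (-t)))).congr_deriv ?_
    ring
  have hcont : Continuous fun s : ℝ => t ^ 2 * ((1 - s) * g2 (z - (s * t) • v)) := by
    simp_rw [hline]
    exact continuous_const.mul ((continuous_const.sub continuous_id).mul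
      ((hc z).comp (by fun_prop : Continuous fun s : ℝ => -(s * t))))
  have hint := intervalIntegral.integral_eq_sub_of_hasDerivAt hF (hcont.intervalIntegrable 0 1)
  rw [intervalIntegral.integral_const_mul] at hint
  rw [hint]
  simp
  ring

end LineDerivatives

/-! ### Product weights with one distinguished coordinate -/

section CoordinateProducts

variable {ι : Type*} [Fintype ι] [DecidableEq ι]

/-- The product weight `∏ᵢ K(uᵢ)` with the factor of index `j` replaced by `M(uⱼ)`. -/
noncomputable def prodWeight (K : ℝ → ℝ) (j : ι) (M : ℝ → ℝ) (u : ι → ℝ) : ℝ :=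
  ∏ i, Function.update (fun _ => K) j M i (u i)

lemma prodWeight_mul (K : ℝ → ℝ) (j : ι) (a : ℝ → ℝ) (u : ι → ℝ) :
    prodWeight K j (fun t => a t * K t) u = a (u j) * ∏ i, K (u i) := by
  have h : ∀ i, Function.update (fun _ => K) j (fun t => a t * K t) i (u i) =
      (if i = j then a (u j) else 1) * K (u i) := by
    intro i
    by_cases hi : i = j
    · subst hi; simp
    · simp [hi]
  simp_rw [prodWeight, h, Finset.prod_mul_distrib]
  simp

lemma integrable_prodWeight {K M : ℝ → ℝ} (hK : Integrable K) (hM : Integrable M) (j : ι) :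
    Integrable (prodWeight K j M) := by
  refine Integrable.fintype_prod (𝕜 := ℝ) (f := Function.update (fun _ : ι => K) j M) fun i => ?_
  by_cases hi : i = j
  · subst hi; simpa using hM
  · simpa [hi] using hK

lemma lintegral_enorm_prodWeight {K M : ℝ → ℝ} (hK : Integrable K) (hM : Integrable M) (j : ι) :
    ∫⁻ u, ‖prodWeight K j M u‖ₑ =
      ENNReal.ofReal ((∫ t, |M t|) * (∫ t, |K t|) ^ (Fintype.card ι - 1)) := by
  rw [← ofReal_integral_norm_eq_lintegral_enorm (integrable_prodWeight hK hM j)]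
  congr 1
  simp_rw [prodWeight, norm_prod]
  rw [integral_fintype_prod_volume_eq_prod
    (fun i t => ‖Function.update (fun _ : ι => K) j M i t‖)]
  have : ∀ i, ∫ t, ‖Function.update (fun _ : ι => K) j M i t‖ =
      Function.update (fun _ : ι => ∫ t, |K t|) j (∫ t, |M t|) i := by
    intro i
    by_cases hi : i = j
    · subst hi; simp
    · simp [hi]
  simp_rw [this]
  rw [Finset.prod_update_of_mem (Finset.mem_univ j), Finset.prod_const, Finset.card_sdiff]
  simp [Finset.card_univ]

/-- `G` ignores the j-th coordinate, so separating that coordinate leaves the factor ∫ M = 0. The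
product formula for integrals needs no integrability of `G`. -/
lemma integral_prodWeight_mul_eq_zero {K M : ℝ → ℝ} {j : ι} (hM : ∫ t, M t = 0)
    {G : (ι → ℝ) → ℝ} (hG : ∀ u t, G (Function.update u j t) = G u) :
    ∫ u, prodWeight K j M u * G u = 0 := by
  classical
  obtain ⟨p, hp⟩ : ∃ p : ι → Prop, ∀ i, p i ↔ i = j := ⟨_, fun _ => Iff.rfl⟩
  let e := MeasurableEquiv.piEquivPiSubtypeProd (fun _ : ι => ℝ) p
  have hmp : MeasurePreserving e := volume_preserving_piEquivPiSubtypeProd (fun _ : ι => ℝ) p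
  rw [← hmp.symm.integral_comp']
  have h1 : ∀ q, ∀ i : {i // p i}, e.symm q i = q.1 i := fun q i => dif_pos i.2
  have h2 : ∀ q, ∀ i : {i // ¬ p i}, e.symm q i = q.2 i := fun q i => dif_neg i.2
  have h : ∀ q, prodWeight K j M (e.symm q) * G (e.symm q) =
      (∏ i : {i // p i}, M (q.1 i)) *
        ((∏ i : {i // ¬ p i}, K (q.2 i)) * G (e.symm (0, q.2))) := by
    intro q
    have h3 : G (e.symm (0, q.2)) = G (e.symm q) := by
      rw [← hG (e.symm q) 0]
      congr 1
      ext i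
      by_cases hi : p i
      · obtain rfl := (hp i).1 hi
        rw [h1 _ ⟨i, hi⟩, Function.update_self]
        rfl
      · rw [h2 _ ⟨i, hi⟩, Function.update_of_ne (fun h => hi ((hp i).2 h)), h2 _ ⟨i, hi⟩]
    rw [h3, ← mul_assoc, prodWeight, ← Fintype.prod_subtype_mul_prod_subtype p]
    congr 2
    · refine Finset.prod_congr rfl fun i _ => ?_
      rw [h1, (hp i).1 i.2, Function.update_self]
    · refine Finset.prod_congr rfl fun i _ => ?_
      rw [h2, Function.update_of_ne (fun h => i.2 ((hp i).2 h))]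
  simp_rw [h]
  have hzero : ∫ x : {i // p i} → ℝ, ∏ i, M (x i) = 0 :=
    (integral_fintype_prod_volume_eq_prod fun (_ : {i // p i}) => M).trans
      (Finset.prod_eq_zero (Finset.mem_univ ⟨j, (hp j).2 rfl⟩) hM)
  refine (integral_prod_mul (fun x : {i // p i} → ℝ => ∏ i, M (x i))
    (fun y : {i // ¬ p i} → ℝ => (∏ i, K (y i)) * G (e.symm (0, y)))).trans ?_
  rw [hzero, zero_mul]

end CoordinateProducts

/-! ### Second-order bias of product-kernel smoothing -/

section SmoothingBias

variable {E ι : Type*} [NormedAddCommGroup E] [NormedSpace ℝ E] [MeasurableSpace E] [BorelSpace E]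
  [SecondCountableTopology E] {μ : Measure E} [SFinite μ] [μ.IsAddRightInvariant]
  [Fintype ι] [DecidableEq ι]

lemma integrable_mul_of_integrable_sq_mul {K : ℝ → ℝ} (hK : Integrable K)
    (hK2 : Integrable fun t => t ^ 2 * K t) : Integrable fun t => t * K t := by
  refine (hK.norm.add hK2.norm).mono
    (continuous_id.aestronglyMeasurable.mul hK.aestronglyMeasurable) (Eventually.of_forall fun t => ?_)
  have h : |t| ≤ 1 + t ^ 2 := by nlinarith [sq_abs t, sq_nonneg (|t| - 1)]
  have h2 : |t| * |K t| ≤ (1 + t ^ 2) * |K t| := by gcongr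
  simp only [Pi.add_apply, Real.norm_eq_abs, abs_mul, abs_pow, sq_abs]
  exact (by linarith : |t| * |K t| ≤ |K t| + t ^ 2 * |K t|).trans (le_abs_self _)

/-- The effect on a weighted average of adding the `j`-th coordinate to the shift. -/
lemma eLpNorm_integral_shift_coord_sub_le {K : ℝ → ℝ} (hK : Integrable K)
    (hK2 : Integrable fun t => t ^ 2 * K t) (hK1 : ∫ t, t * K t = 0) {g : E → ℝ}
    (hg : Measurable g) (v : E)
    (hd : ∀ z, LineDifferentiableAt ℝ g z v)
    (hd1 : ∀ z, LineDifferentiableAt ℝ (fun z => lineDeriv ℝ g z v) z v)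
    (hc : ∀ z, Continuous fun r : ℝ => lineDeriv ℝ (fun z => lineDeriv ℝ g z v) (z + r • v) v)
    (hg1 : MemLp (fun z => lineDeriv ℝ g z v) 2 μ)
    (hg2 : MemLp (fun z => lineDeriv ℝ (fun z => lineDeriv ℝ g z v) z v) 2 μ)
    (j : ι) {τ : (ι → ℝ) → E} (hτ : Measurable τ)
    (hτj : ∀ u t, τ (Function.update u j t) = τ u) :
    eLpNorm (fun z => ∫ u : ι → ℝ, (∏ i, K (u i)) * (g (z - τ u - u j • v) - g (z - τ u))) 2 μ ≤
      ENNReal.ofReal ((∫ t, t ^ 2 * |K t|) * (∫ t, |K t|) ^ (Fintype.card ι - 1)) *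
        eLpNorm (fun z => lineDeriv ℝ (fun z => lineDeriv ℝ g z v) z v) 2 μ := by
  set g1 := fun z => lineDeriv ℝ g z v with hg1_def
  set g2 := fun z => lineDeriv ℝ g1 z v with hg2_def
  have hg1m : Measurable g1 := measurable_lineDeriv_of_lineDifferentiableAt hg hd
  have hg2m : Measurable g2 := measurable_lineDeriv_of_lineDifferentiableAt hg1m hd1
  have hW1 := integrable_prodWeight hK (integrable_mul_of_integrable_sq_mul hK hK2) j
  have hW2 := integrable_prodWeight hK hK2 j
  -- Treating the Taylor variable s as a further parameter makes the remainder a single weighted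
  -- average of translates of `g2`.
  let ν : Measure ((ι → ℝ) × ℝ) := volume.prod (volume.restrict (Set.Ioc 0 1))
  let k : (ι → ℝ) × ℝ → ℝ := fun q => prodWeight K j (fun t => t ^ 2 * K t) q.1 * (1 - q.2)
  have hs : Integrable (fun s : ℝ => 1 - s) (volume.restrict (Set.Ioc 0 1)) :=
    ((continuous_const.sub continuous_id).integrableOn_Ioc)
  have hk : Integrable k ν := hW2.mul_prod hs
  have hσ : Measurable fun q : (ι → ℝ) × ℝ => τ q.1 + (q.2 * q.1 j) • v := by fun_prop
  have hkey : (fun z => ∫ u : ι → ℝ, (∏ i, K (u i)) * (g (z - τ u - u j • v) - g (z - τ u)))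
      =ᵐ[μ] fun z => ∫ q, k q * g2 (z - (τ q.1 + (q.2 * q.1 j) • v)) ∂ν := by
    filter_upwards [ae_integrable_mul_translate hW1 hτ hg1m hg1,
      ae_integrable_mul_translate hk hσ hg2m hg2] with z h1 h2
    have h3 : ∀ u : ι → ℝ, (∏ i, K (u i)) * (g (z - τ u - u j • v) - g (z - τ u)) =
        (∫ s in Set.Ioc (0 : ℝ) 1, k (u, s) * g2 (z - (τ u + (s * u j) • v))) -
          prodWeight K j (fun t => t * K t) u * g1 (z - τ u) := by
      intro u
      rw [eq_add_integral_of_lineDifferentiableAt hd hd1 hc (z - τ u) (u j),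
        intervalIntegral.integral_of_le zero_le_one, prodWeight_mul K j (fun t => t)]
      simp only [k, prodWeight_mul K j (fun t => t ^ 2), mul_assoc, integral_const_mul, sub_sub]
      ring
    simp_rw [h3]
    -- The first-order term drops out: `g1 (z - τ u)` does not depend on `u j`, whose weight t·K(t)
    -- integrates to zero.
    rw [integral_sub h2.integral_prod_left h1,
      integral_prodWeight_mul_eq_zero hK1 (fun u t => by rw [hτj]), sub_zero]
    exact (integral_prod _ h2).symm
  rw [eLpNorm_congr_ae hkey]
  refine (eLpNorm_integral_mul_translate_le hk hσ hg2m).trans ?_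
  gcongr
  simp only [k, enorm_mul]
  rw [lintegral_prod_mul hW2.aestronglyMeasurable.enorm hs.aestronglyMeasurable.enorm,
    lintegral_enorm_prodWeight hK hK2]
  have h1 : ∫⁻ s in Set.Ioc (0 : ℝ) 1, ‖1 - s‖ₑ ≤ 1 := by
    calc _ ≤ ∫⁻ s in Set.Ioc (0 : ℝ) 1, 1 := by
          refine setLIntegral_mono measurable_const fun s hs => ?_
          rw [Real.enorm_eq_ofReal (by linarith [hs.2]), ENNReal.ofReal_le_one]
          linarith [hs.1]
      _ = 1 := by simp
  simp only [abs_mul, abs_pow, sq_abs]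
  exact mul_le_of_le_one_right' h1

/-- The bias of smoothing by a product kernel `∏ᵢ K(uᵢ)` along the directions `e i` is of second
order in the `L²` norm. -/
lemma eLpNorm_integral_prod_translate_sub_le {K : ℝ → ℝ} (hK : Integrable K)
    (hK2 : Integrable fun t => t ^ 2 * K t) (hK1 : ∫ t, t * K t = 0) (hK0 : ∫ t, K t = 1)
    {g : E → ℝ} (hg : Measurable g) (hg0 : MemLp g 2 μ) (e : ι → E)
    (hd : ∀ i z, LineDifferentiableAt ℝ g z (e i))
    (hd1 : ∀ i z, LineDifferentiableAt ℝ (fun z => lineDeriv ℝ g z (e i)) z (e i))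
    (hc : ∀ i z, Continuous fun r : ℝ =>
      lineDeriv ℝ (fun z => lineDeriv ℝ g z (e i)) (z + r • e i) (e i))
    (hg1 : ∀ i, MemLp (fun z => lineDeriv ℝ g z (e i)) 2 μ)
    (hg2 : ∀ i, MemLp (fun z => lineDeriv ℝ (fun z => lineDeriv ℝ g z (e i)) z (e i)) 2 μ) :
    eLpNorm (fun z => (∫ u : ι → ℝ, (∏ i, K (u i)) * g (z - ∑ i, u i • e i)) - g z) 2 μ ≤
      ENNReal.ofReal ((∫ t, t ^ 2 * |K t|) * (∫ t, |K t|) ^ (Fintype.card ι - 1)) *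
        ∑ i, eLpNorm (fun z => lineDeriv ℝ (fun z => lineDeriv ℝ g z (e i)) z (e i)) 2 μ := by
  have hW : Integrable fun u : ι → ℝ => ∏ i, K (u i) :=
    Integrable.fintype_prod (𝕜 := ℝ) fun _ => hK
  have hτ : ∀ s : Finset ι, Measurable fun u : ι → ℝ => ∑ i ∈ s, u i • e i := fun s => by fun_prop
  have hone : ∫ u : ι → ℝ, ∏ i, K (u i) = 1 := by
    rw [integral_fintype_prod_volume_eq_prod fun (_ : ι) => K]
    simp [hK0]
  -- Telescoping over the set of active shifts. The full product weight is kept throughout, and its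
  -- total mass 1 settles the empty set.
  suffices h : ∀ s : Finset ι,
      eLpNorm (fun z => (∫ u : ι → ℝ, (∏ i, K (u i)) * g (z - ∑ i ∈ s, u i • e i)) - g z) 2 μ ≤
        ENNReal.ofReal ((∫ t, t ^ 2 * |K t|) * (∫ t, |K t|) ^ (Fintype.card ι - 1)) * ∑ i ∈ s,
          eLpNorm (fun z => lineDeriv ℝ (fun z => lineDeriv ℝ g z (e i)) z (e i)) 2 μ from
    h Finset.univ
  intro s
  induction s using Finset.induction_on with
  | empty => simp [integral_mul_const, hone]
  | insert j s hj ih =>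
    have hsplit : (fun z => (∫ u : ι → ℝ, (∏ i, K (u i)) *
        g (z - ∑ i ∈ insert j s, u i • e i)) - g z) =ᵐ[μ]
        (fun z => ∫ u : ι → ℝ, (∏ i, K (u i)) *
          (g (z - ∑ i ∈ s, u i • e i - u j • e j) - g (z - ∑ i ∈ s, u i • e i))) +
        fun z => (∫ u : ι → ℝ, (∏ i, K (u i)) * g (z - ∑ i ∈ s, u i • e i)) - g z := by
      filter_upwards [ae_integrable_mul_translate hW (hτ s) hg hg0,
        ae_integrable_mul_translate hW (hτ (insert j s)) hg hg0] with z h1 h2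
      have h : ∀ u : ι → ℝ, z - ∑ i ∈ insert j s, u i • e i =
          z - ∑ i ∈ s, u i • e i - u j • e j := fun u => by
        rw [Finset.sum_insert hj]
        abel
      simp_rw [h] at h2 ⊢
      simp only [Pi.add_apply, mul_sub]
      rw [integral_sub h2 h1]
      ring
    have hstep : AEStronglyMeasurable (fun z => ∫ u : ι → ℝ, (∏ i, K (u i)) *
        (g (z - ∑ i ∈ s, u i • e i - u j • e j) - g (z - ∑ i ∈ s, u i • e i))) μ := by
      have hm : Measurable fun q : E × (ι → ℝ) =>
          g (q.1 - ∑ i ∈ s, q.2 i • e i - q.2 j • e j) - g (q.1 - ∑ i ∈ s, q.2 i • e i) := by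
        fun_prop
      exact AEStronglyMeasurable.integral_prod_right'
        (f := fun q : E × (ι → ℝ) => (∏ i, K (q.2 i)) *
          (g (q.1 - ∑ i ∈ s, q.2 i • e i - q.2 j • e j) - g (q.1 - ∑ i ∈ s, q.2 i • e i)))
        (hW.aestronglyMeasurable.comp_snd.mul hm.aestronglyMeasurable)
    rw [eLpNorm_congr_ae hsplit, Finset.sum_insert hj, mul_add]
    refine (eLpNorm_add_le hstep ((aestronglyMeasurable_integral_mul_translate hW (hτ s) hg).sub
      hg.aestronglyMeasurable) (by norm_num)).trans (add_le_add ?_ ih)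
    refine eLpNorm_integral_shift_coord_sub_le hK hK2 hK1 hg (e j) (hd j) (hd1 j) (hc j) (hg1 j)
      (hg2 j) j (hτ s) fun u t => Finset.sum_congr rfl fun i hi => ?_
    rw [Function.update_of_ne (ne_of_mem_of_not_mem hi hj)]

end SmoothingBias

/-! ### Moments of the rescaled kernel -/

section ScaledKernel

variable {K : ℝ → ℝ} {h : ℝ}

lemma integral_scaled (M : ℝ → ℝ) (hh : 0 < h) : ∫ t, M (t / h) / h = ∫ t, M t := by
  rw [integral_div, Measure.integral_comp_div, abs_of_pos hh, smul_eq_mul,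
    mul_div_cancel_left₀ _ hh.ne']

lemma integrable_scaled {M : ℝ → ℝ} (hM : Integrable M) (hh : 0 < h) :
    Integrable fun t => M (t / h) / h :=
  (hM.comp_div hh.ne').div_const h

lemma integrable_sq_mul_scaled (hK2 : Integrable fun t => t ^ 2 * K t) (hh : 0 < h) :
    Integrable fun t => t ^ 2 * (K (t / h) / h) := by
  refine ((integrable_scaled hK2 hh).const_mul (h ^ 2)).congr (Eventually.of_forall fun t => ?_)
  field_simp

lemma integral_mul_scaled (hh : 0 < h) :
    ∫ t, t * (K (t / h) / h) = h * ∫ t, t * K t := by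
  rw [← integral_scaled (fun t => t * K t) hh, ← integral_const_mul]
  refine integral_congr_ae (Eventually.of_forall fun t => ?_)
  field_simp

lemma integral_abs_scaled (hh : 0 < h) : ∫ t, |K (t / h) / h| = ∫ t, |K t| := by
  rw [← integral_scaled (fun t => |K t|) hh]
  simp_rw [abs_div, abs_of_pos hh]

/-- The source of the rate: the absolute second moment gains h², while the L¹ norm is unchanged by
rescaling. -/
lemma integral_sq_mul_abs_scaled (hh : 0 < h) :
    ∫ t, t ^ 2 * |K (t / h) / h| = h ^ 2 * ∫ t, t ^ 2 * |K t| := by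
  rw [← integral_scaled (fun t => t ^ 2 * |K t|) hh, ← integral_const_mul]
  refine integral_congr_ae (Eventually.of_forall fun t => ?_)
  simp only [abs_div, abs_of_pos hh]
  field_simp

end ScaledKernel

/-! ### The smoothed density -/

section SmoothedDensity

variable {d : ℕ} {K : ℝ → ℝ} {h : ℝ}

instance : (volume : Measure ((Fin d → ℝ) × (Fin d → ℝ))).IsAddHaarMeasure :=
  Measure.prod.instIsAddHaarMeasure volume volume

lemma sum_smul_coordDir (u : Fin d ⊕ Fin d → ℝ) :
    ∑ i, u i • coordDir i = (fun i => u (Sum.inl i), fun i => u (Sum.inr i)) := by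
  rw [Fintype.sum_sum_type]
  ext i <;> simp [coordDir, Prod.fst_sum, Prod.snd_sum, Finset.sum_apply, Pi.single_apply]

/-- Substituting y = z − u and identifying ℝ^d × ℝ^d with functions on `Fin d ⊕ Fin d` merges the
two kernels into one product over 2d coordinates. -/
lemma smoothed_eq_integral_coord (p : (Fin d → ℝ) × (Fin d → ℝ) → ℝ)
    (z : (Fin d → ℝ) × (Fin d → ℝ)) :
    smoothed K h p z = ∫ u : Fin d ⊕ Fin d → ℝ,
      (∏ i, K (u i / h) / h) * p (z - ∑ i, u i • coordDir i) := by
  have : (volume : Measure ((Fin d → ℝ) × (Fin d → ℝ))).IsNegInvariant :=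
    ⟨((Measure.measurePreserving_neg (volume : Measure (Fin d → ℝ))).prod
      (Measure.measurePreserving_neg (volume : Measure (Fin d → ℝ)))).map_eq⟩
  rw [smoothed, ← integral_sub_left_eq_self _ volume z,
    ← (volume_measurePreserving_sumPiEquivProdPi fun _ : Fin d ⊕ Fin d => ℝ).integral_comp']
  refine integral_congr_ae (Eventually.of_forall fun u => ?_)
  simp only [sum_smul_coordDir, Fintype.prod_sum_type, productKernel,
    MeasurableEquiv.coe_sumPiEquivProdPi, Equiv.sumPiEquivProdPi, Equiv.coe_fn_mk, Prod.fst_sub,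
    Prod.snd_sub, sub_sub_cancel]
  ring

lemma integrable_productKernel (hK : Integrable K) (hh : 0 < h) :
    Integrable (productKernel K h : (Fin d → ℝ) → ℝ) :=
  Integrable.fintype_prod (𝕜 := ℝ) fun _ => integrable_scaled hK hh

lemma memLp_smoothed (hK : Integrable K) (hh : 0 < h) {p : (Fin d → ℝ) × (Fin d → ℝ) → ℝ}
    (hp : Measurable p) (hp2 : MemLp p 2) : MemLp (smoothed K h p) 2 := by
  have := memLp_integral_mul_translate (μ := volume)
    (Integrable.fintype_prod (𝕜 := ℝ) fun _ : Fin d ⊕ Fin d => integrable_scaled hK hh)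
    (τ := fun u => ∑ i, u i • coordDir i) (by fun_prop) hp hp2
  exact this.ae_eq (Eventually.of_forall fun z => (smoothed_eq_integral_coord p z).symm)

lemma memLp_convolution (hK : Integrable K) (hh : 0 < h) {a : (Fin d → ℝ) → ℝ}
    (ha : Measurable a) (ha2 : MemLp a 2) :
    MemLp (fun x => ∫ y, a y * productKernel K h (x - y)) 2 := by
  refine (memLp_integral_mul_translate (μ := volume) (integrable_productKernel hK hh)
    measurable_id ha ha2).ae_eq (Eventually.of_forall fun x => ?_)
  beta_reduce
  rw [← integral_sub_left_eq_self _ volume x]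
  simp [mul_comm]

lemma ae_integrable_convolution (hK : Integrable K) (hh : 0 < h) {a : (Fin d → ℝ) → ℝ}
    (ha : Measurable a) (ha2 : MemLp a 2) :
    ∀ᵐ x, Integrable fun y => a y * productKernel K h (x - y) := by
  filter_upwards [ae_integrable_mul_translate (μ := volume) (integrable_productKernel hK hh)
    measurable_id ha ha2] with x hx
  have := hx.comp_sub_left x
  simpa [mul_comm] using this

/-- Smoothing preserves finite sums of products. -/
lemma smoothed_sum_mul_ae_eq {ι : Type*} (s : Finset ι) (hK : Integrable K) (hh : 0 < h)
    {a b : ι → (Fin d → ℝ) → ℝ} (ha : ∀ i, Measurable (a i)) (ha2 : ∀ i, MemLp (a i) 2)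
    (hb : ∀ i, Measurable (b i)) (hb2 : ∀ i, MemLp (b i) 2) :
    smoothed K h (fun y => ∑ i ∈ s, a i y.1 * b i y.2) =ᵐ[volume.prod volume] fun z =>
      ∑ i ∈ s, (∫ y, a i y * productKernel K h (z.1 - y)) *
        ∫ y, b i y * productKernel K h (z.2 - y) := by
  -- An L² function convolved with an L¹ kernel is only known to converge almost everywhere, so the
  -- factorization is almost everywhere too.
  have h1 : ∀ᵐ z : (Fin d → ℝ) × (Fin d → ℝ) ∂(volume.prod volume), ∀ i ∈ s,
      Integrable (fun y => a i y * productKernel K h (z.1 - y)) :=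
    (ae_ball_iff s.countable_toSet).2 fun i _ =>
      Measure.quasiMeasurePreserving_fst.ae (ae_integrable_convolution hK hh (ha i) (ha2 i))
  have h2 : ∀ᵐ z : (Fin d → ℝ) × (Fin d → ℝ) ∂(volume.prod volume), ∀ i ∈ s,
      Integrable (fun y => b i y * productKernel K h (z.2 - y)) :=
    (ae_ball_iff s.countable_toSet).2 fun i _ =>
      Measure.quasiMeasurePreserving_snd.ae (ae_integrable_convolution hK hh (hb i) (hb2 i))
  filter_upwards [h1, h2] with z hz1 hz2
  have hsum : ∀ y : (Fin d → ℝ) × (Fin d → ℝ), (∑ i ∈ s, a i y.1 * b i y.2) *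
      productKernel K h (z.1 - y.1) * productKernel K h (z.2 - y.2) =
      ∑ i ∈ s, (a i y.1 * productKernel K h (z.1 - y.1)) *
        (b i y.2 * productKernel K h (z.2 - y.2)) := fun y => by
    rw [Finset.sum_mul, Finset.sum_mul]
    exact Finset.sum_congr rfl fun i _ => by ring
  simp_rw [smoothed, hsum]
  rw [Measure.volume_eq_prod, integral_finsetSum _ fun i hi => (hz1 i hi).mul_prod (hz2 i hi)]
  exact Finset.sum_congr rfl fun i _ => integral_prod_mul
    (fun y => a i y * productKernel K h (z.1 - y)) fun y => b i y * productKernel K h (z.2 - y)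

/-- The smoothing bias in `L²` is of order `h²`. -/
lemma exists_eLpNorm_smoothed_sub_le (hK : Integrable K) (hK2 : Integrable fun t => t ^ 2 * K t)
    (hK1 : ∫ t, t * K t = 0) (hK0 : ∫ t, K t = 1) {p : (Fin d → ℝ) × (Fin d → ℝ) → ℝ}
    (hpm : Measurable p) (hp : HasIntegrablePartials 3 p) :
    ∃ C : ℝ, ∀ h : ℝ, 0 < h →
      (eLpNorm (fun z => p z - smoothed K h p z) 2 (volume.prod volume)).toReal ≤ C * h ^ 2 := by
  obtain ⟨⟨-, hp0⟩, hp1⟩ := hp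
  have hg2 : ∀ i, MemLp (fun z => lineDeriv ℝ (fun z => lineDeriv ℝ p z (coordDir i)) z
      (coordDir i)) 2 := fun i => (((hp1 i).2.2 i).2).1.2
  set B := ∑ i, eLpNorm (fun z => lineDeriv ℝ (fun z => lineDeriv ℝ p z (coordDir i)) z
    (coordDir i)) 2 (volume : Measure ((Fin d → ℝ) × (Fin d → ℝ))) with hB
  have hBtop : B ≠ ⊤ := ENNReal.sum_ne_top.2 fun i _ => (hg2 i).2.ne
  -- One coordinate contributes the second moment and the other 2d − 1 the L¹ norm of K. For d = 0
  -- the truncated exponent is harmless, as `B` is an empty sum.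
  refine ⟨(∫ t, t ^ 2 * |K t|) * (∫ t, |K t|) ^ (Fintype.card (Fin d ⊕ Fin d) - 1) * B.toReal,
    fun h hh => ?_⟩
  have hmain := eLpNorm_integral_prod_translate_sub_le (μ := volume) (integrable_scaled hK hh)
    (integrable_sq_mul_scaled hK2 hh) (by rw [integral_mul_scaled hh, hK1, mul_zero])
    ((integral_scaled K hh).trans hK0) hpm hp0 coordDir (fun i => (hp1 i).1)
    (fun i => ((hp1 i).2.2 i).1)
    -- Differentiability of the second derivative, the third-order hypothesis, gives its continuity
    -- along lines.
    (fun i => continuous_comp_line ((((hp1 i).2.2 i).2).2 i).1)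
    (fun i => (hp1 i).2.1.2) hg2
  simp_rw [← smoothed_eq_integral_coord, integral_abs_scaled hh, integral_sq_mul_abs_scaled hh,
    ← hB] at hmain
  have hcomm : eLpNorm (fun z => p z - smoothed K h p z) 2 (volume.prod volume) =
      eLpNorm (fun z => smoothed K h p z - p z) 2 volume :=
    eLpNorm_sub_comm p (smoothed K h p) 2 volume
  rw [hcomm]
  refine (ENNReal.toReal_mono (ENNReal.mul_ne_top ENNReal.ofReal_ne_top hBtop) hmain).trans_eq ?_
  have : 0 ≤ ∫ t, t ^ 2 * |K t| := integral_nonneg fun t => by positivity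
  have : 0 ≤ ∫ t, |K t| := integral_nonneg fun t => abs_nonneg _
  rw [ENNReal.toReal_mul, ENNReal.toReal_ofReal (by positivity)]
  ring

end SmoothedDensity

/-! ### Regularity of the pair density -/

section PairDensity

variable {d L : ℕ} {f : Fin L → (Fin d → ℝ) → ℝ}

lemma measurable_nextDensity (A : Matrix (Fin L) (Fin L) ℝ) (hf : ∀ ℓ, Measurable (f ℓ))
    (ℓ : Fin L) : Measurable (nextDensity A f ℓ) :=
  Finset.measurable_fun_sum _ fun m _ => (hf m).const_mul _

lemma memLp_nextDensity (A : Matrix (Fin L) (Fin L) ℝ) (hf : ∀ ℓ, MemLp (f ℓ) 2)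
    (ℓ : Fin L) : MemLp (nextDensity A f ℓ) 2 :=
  memLp_finsetSum _ fun m _ => (hf m).const_mul _

lemma measurable_pairDensity (A : Matrix (Fin L) (Fin L) ℝ) (w : Fin L → ℝ)
    (hf : ∀ ℓ, Measurable (f ℓ)) : Measurable (pairDensity A w f) :=
  Finset.measurable_fun_sum _ fun ℓ _ =>
    (((hf ℓ).comp measurable_fst).const_mul _).mul
      ((measurable_nextDensity A hf ℓ).comp measurable_snd)

end PairDensity

end HMM

theorem lemma2 {d L : ℕ} (A : Matrix (Fin L) (Fin L) ℝ) (w : Fin L → ℝ)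
    (f : Fin L → (Fin d → ℝ) → ℝ) (K : ℝ → ℝ)
    (hA : HMM.IsRegularChain A w)
    (hf : HMM.IsEmissionFamily f)
    (hK : HMM.IsSmoothingKernel K)
    (hp : HMM.HasIntegrablePartials 3 (HMM.pairDensity A w f)) :
    (∀ h : ℝ, 0 < h → MemLp (HMM.smoothed K h (HMM.pairDensity A w f)) 2) ∧
    (fun h : ℝ => ∑ ℓ ∈ Finset.Icc 1 L,
        (HMM.singularValue (HMM.operatorT A w f) ℓ
          - HMM.singularValue (HMM.operatorTh A w f K h) ℓ) ^ 2)
      =O[𝓝[>] (0 : ℝ)] fun h => h ^ 4 := by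
  have hKi : Integrable K := memLp_one_iff_integrable.1 hK.memLp_one
  have hpm := HMM.measurable_pairDensity A w hf.measurable
  have hp2 : MemLp (HMM.pairDensity A w f) 2 := hp.1.2
  have hsm : ∀ h : ℝ, 0 < h → MemLp (HMM.smoothed K h (HMM.pairDensity A w f)) 2 :=
    fun h hh => HMM.memLp_smoothed hKi hh hpm hp2
  refine ⟨hsm, ?_⟩
  -- Absorbing the weight into the first factor makes the pair density definitionally a sum of
  -- products.
  have ha : ∀ ℓ, Measurable fun x => w ℓ * f ℓ x := fun ℓ => (hf.measurable ℓ).const_mul _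
  have ha2 : ∀ ℓ, MemLp (fun x => w ℓ * f ℓ x) 2 := fun ℓ => (hf.square_integrable ℓ).const_mul _
  have hb := HMM.measurable_nextDensity A hf.measurable
  have hb2 := HMM.memLp_nextDensity A hf.square_integrable
  have hT : IsCompactOperator (HMM.operatorT A w f) :=
    HMM.isCompactOperator_integralOperator Finset.univ ha2 hb2 (EventuallyEq.refl _ _)
  have hTh : ∀ h : ℝ, 0 < h → IsCompactOperator (HMM.operatorTh A w f K h) := fun h hh =>
    HMM.isCompactOperator_integralOperator Finset.univ
      (fun ℓ => HMM.memLp_convolution hKi hh (ha ℓ) (ha2 ℓ))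
      (fun ℓ => HMM.memLp_convolution hKi hh (hb ℓ) (hb2 ℓ))
      (HMM.smoothed_sum_mul_ae_eq Finset.univ hKi hh ha ha2 hb hb2)
  obtain ⟨C, hC⟩ := HMM.exists_eLpNorm_smoothed_sub_le hKi hK.integrable_sq_mul hK.first_moment
    hK.integral_eq_one hpm hp
  refine Asymptotics.IsBigO.of_bound (L * C ^ 2) ?_
  filter_upwards [self_mem_nhdsWithin] with h hh
  have hh : 0 < h := hh
  have hnorm : ‖HMM.operatorT A w f - HMM.operatorTh A w f K h‖ ≤ C * h ^ 2 :=
    (HMM.norm_integralOperator_sub_le hp2 (hsm h hh)).trans (hC h hh)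
  rw [Real.norm_of_nonneg (Finset.sum_nonneg fun _ _ => sq_nonneg _),
    Real.norm_of_nonneg (by positivity)]
  calc _ ≤ ∑ ℓ ∈ Finset.Icc 1 L, (C * h ^ 2) ^ 2 := Finset.sum_le_sum fun ℓ hℓ =>
        sq_le_sq' (abs_le.1 ((HMM.abs_singularValue_sub_le hT (hTh h hh)
          (Finset.mem_Icc.1 hℓ).1).trans hnorm)).1 (abs_le.1 ((HMM.abs_singularValue_sub_le hT
          (hTh h hh) (Finset.mem_Icc.1 hℓ).1).trans hnorm)).2
    _ = L * C ^ 2 * h ^ 4 := by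
        rw [Finset.sum_const, Nat.card_Icc, nsmul_eq_mul, Nat.add_sub_cancel]
        ring
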